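/- \textbf{Setting.} An NFA $\mathcal A=\langle\Sigma,Q,\delta,Q_0,\alpha\rangle$ has a finite alphabet $\Sigma$, a finite set of states $Q$, a transition function $\delta:Q\times\Sigma\to 2^Q$, initial states $Q_0\subseteq Q$ and accepting states $\alpha\subseteq Q$; $\mathfrak L(\mathcal A)\subseteq\Sigma^*$ is the language it accepts. For words $x,y\in\Sigma^*$ write $x\sim y$ if $y$ is a permutation of $x$, and then let $d_H(x,y)=|\{i : x_i\ne y_i\}|$. Viewed as a jumping finite automaton (JFA), $\mathcal A$ has the jumping language $\mathfrak J(\mathcal A)=\{w\in\Sigma^* : \exists u,\ w\sim u,\ u\in\mathfrak L(\mathcal A)\}$. The Hamming cost of $w\in\Sigma^*$ is \[\mathcal A_{\mathrm{ham}}(w)=\min\{d_H(w',w) : w'\in\mathfrak L(\mathcal A),\ w'\sim w\},\qquad \min\emptyset=\infty .\] For $k\in\mathbb N$ the \emph{$k$-balance automaton} $\mathcal B_k$ of $\mathcal A$ is the NFA over $\Sigma$ with states $(q,f,c)\in Q\times\{-k,\dots,k\}^{\Sigma}\times\{0,\dots,k\}$; its initial states are those with $q\in Q_0$, $f\equiv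 0$, $c=0$, and its accepting states are those with $q\in\alpha$, $f\equiv 0$. On a letter $\sigma$ it can move from $(q,f,c)$ to $(q',f',c')$ iff either $q'\in\delta(q,\sigma)$, $f'=f$ and $c'=c$; or, for some letter $\tau\neq\sigma$, $q'\in\delta(q,\tau)$, $c'=c+1$, $f'(\sigma)=f(\sigma)-1$, $f'(\tau)=f(\tau)+1$, and $f'=f$ on all other letters. \textbf{Theorem.} \begin{enumerate} \item For every NFA $\mathcal A$ and every $k\in\mathbb N$, $\mathfrak L(\mathcal B_k)=\{w\in\Sigma^* : \mathcal A_{\mathrm{ham}}(w)\le k\}$. Moreover $\mathcal B_k$ can be constructed effectively: there is a computable function that maps (a finite description of) $\mathcal A$ and $k$ to a finite description of an NFA over $\Sigma$ which is equal to $\mathcal B_k$ up to a renaming of states, and so accepts this language. \item The following problems are decidable: \begin{itemize} \item $k$-Bnd, for every fixed $k\in\mathbb N$: given a JFA $\mathcal A$, decide whether $\mathcal A_{\mathrm{ham}}(w)\le k$ for all $w\in\mathfrak J(\mathcal A)$; \item Param-Bnd: given a JFA $\mathcal A$ and $k\in\mathbb N$, decide whether $\mathcal A_{\mathrm{ham}}(w)\le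 k$ for all $w\in\mathfrak J(\mathcal A)$; \item Univ-$k$-Bnd, for every fixed $k\in\mathbb N$: given a JFA $\mathcal A$, decide whether $\mathcal A_{\mathrm{ham}}(w)\le k$ for all $w\in\Sigma^*$; \item Univ-Param-Bnd: given a JFA $\mathcal A$ and $k\in\mathbb N$, decide whether $\mathcal A_{\mathrm{ham}}(w)\le k$ for all $w\in\Sigma^*$. \end{itemize} The alphabet is part of the input in all four problems. \end{enumerate} -/

import Mathlib

namespace HamJFA

section Semantics

/-- The number of positions at which two words (of equal length) differ. -/
def hamDist {α : Type*} [DecidableEq α] (x y : List α) : ℕ :=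
  (x.zip y).countP fun p => p.1 ≠ p.2

/-- The jumping language of an automaton: the words having an accepted permutation. -/
def jumpLang {α σ : Type*} (A : NFA α σ) : Language α :=
  {w | ∃ u : List α, w.Perm u ∧ u ∈ A.accepts}

/-- The Hamming cost of a word: the least Hamming distance to an accepted permutation of it
(an infimum in `ℕ∞`; it is `⊤` if there is no such permutation). -/
noncomputable def hamCost {α σ : Type*} [DecidableEq α] (A : NFA α σ) (w : List α) : ℕ∞ :=
  ⨅ (w' : List α) (_ : w' ∈ A.accepts ∧ w'.Perm w), (hamDist w' w : ℕ∞)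

/-- Every word of the jumping language has Hamming cost at most `k`. -/
def Bnd {α σ : Type*} [DecidableEq α] (A : NFA α σ) (k : ℕ) : Prop :=
  ∀ w : List α, w ∈ jumpLang A → hamCost A w ≤ k

/-- Every word whatsoever has Hamming cost at most `k`. -/
def UnivBnd {α σ : Type*} [DecidableEq α] (A : NFA α σ) (k : ℕ) : Prop :=
  ∀ w : List α, hamCost A w ≤ k

end Semantics

section Balance

/-- States of the balance automaton: a state of the simulated automaton, a balance in `[-k, k]`
for each letter, and the number of letters swapped so far, in `[0, k]`. -/
abbrev BalanceState (α σ : Type*) (k : ℕ) : Type _ :=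
  σ × (α → Set.Icc (-(k : ℤ)) (k : ℤ)) × Fin (k + 1)

/-- The automaton that reads `w` while simulating `A` on a guessed word `w'`. The balance of a
letter is its number of occurrences in the part of `w'` guessed so far minus its number of
occurrences in the part of `w` read so far. -/
def balanceNFA {α σ : Type*} (A : NFA α σ) (k : ℕ) : NFA α (BalanceState α σ k) where
  step := fun s a => {t |
    (t.1 ∈ A.step s.1 a ∧ t.2.1 = s.2.1 ∧ t.2.2 = s.2.2) ∨
    ∃ b : α, b ≠ a ∧ t.1 ∈ A.step s.1 b ∧
      (t.2.2 : ℕ) = (s.2.2 : ℕ) + 1 ∧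
      (t.2.1 a : ℤ) = (s.2.1 a : ℤ) - 1 ∧
      (t.2.1 b : ℤ) = (s.2.1 b : ℤ) + 1 ∧
      ∀ d : α, d ≠ a → d ≠ b → t.2.1 d = s.2.1 d}
  start := {s | s.1 ∈ A.start ∧ (∀ a : α, (s.2.1 a : ℤ) = 0) ∧ (s.2.2 : ℕ) = 0}
  accept := {s | s.1 ∈ A.accept ∧ ∀ a : α, (s.2.1 a : ℤ) = 0}

/-- Two automata over the same alphabet are equal up to a renaming of the states. -/
def Isomorphic {α σ τ : Type*} (A : NFA α σ) (B : NFA α τ) : Prop :=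
  ∃ e : σ ≃ τ,
    (∀ (s : σ) (a : α) (t : σ), t ∈ A.step s a ↔ e t ∈ B.step (e s) a) ∧
    (∀ s : σ, s ∈ A.start ↔ e s ∈ B.start) ∧
    (∀ s : σ, s ∈ A.accept ↔ e s ∈ B.accept)

end Balance

section Encoding

/-- A finite description of an automaton: the number of states, the list of transitions
`(source, letter, target)`, the list of initial states and the list of accepting states.
States and letters are written as natural numbers. -/
structure NFACode where
  numStates : ℕ
  trans : List (ℕ × ℕ × ℕ)
  init : List ℕ
  final : List ℕ

/-- The automaton over the alphabet `Fin m` given by a description. Entries of the lists that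
mention a letter or a state out of range play no role. -/
def NFACode.toNFA (c : NFACode) (m : ℕ) : NFA (Fin m) (Fin c.numStates) where
  step := fun q a => {q' | ((q : ℕ), (a : ℕ), (q' : ℕ)) ∈ c.trans}
  start := {q | (q : ℕ) ∈ c.init}
  accept := {q | (q : ℕ) ∈ c.final}

/-- A description is a quadruple of natural numbers and lists. -/
def NFACode.equivProd :
    NFACode ≃ ℕ × List (ℕ × ℕ × ℕ) × List ℕ × List ℕ where
  toFun c := (c.numStates, c.trans, c.init, c.final)
  invFun p := ⟨p.1, p.2.1, p.2.2.1, p.2.2.2⟩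
  left_inv _ := rfl
  right_inv _ := rfl

instance NFACode.instPrimcodable : Primcodable NFACode := Primcodable.ofEquiv _ NFACode.equivProd

/-- An input of the decision problems: the number `m` of letters, and a description of a jumping
automaton over the alphabet `Fin m`. -/
abbrev JFACode : Type := ℕ × NFACode

/-- The automaton presented by an input. -/
def JFACode.toNFA (J : JFACode) : NFA (Fin J.1) (Fin J.2.numStates) :=
  J.2.toNFA J.1

end Encoding

end HamJFA

/-! After reading `w`, the automaton `balanceNFA A k` can be in state `(q, f, c)` exactly when some
`v` of the same length leads `A` to `q`, differs from `w` in `c` positions, and has letter counts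
exceeding those of `w` by `f` (`mem_balanceNFA_eval_iff`). Confining `f` to `[-k, k]` loses no run,
because a difference of counts never exceeds the Hamming distance, which is at most `k`. Zero
balances at the end say that `v` is a permutation of `w`, so the accepted words are those of cost at
most `k`.

Universal boundedness is therefore universality of the balance automaton. For boundedness on the
jumping language, the language of the balance automaton lies between the language of `A` and its
closure under permutation, so it fills that closure iff it is itself closed under permutation.
Adjacent transpositions generate all permutations, so it is enough to test exchanges of two adjacent
letters (`bnd_iff_forall_swap`).

Both properties can be tested on short words: the subset construction shortens a prefix, and a
product of two subset constructions shortens a common suffix (`NFA.forall_swap_iff_length_le`). What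
remains is a bounded search. Numbering the states of the balance automaton in mixed radix makes its
description, and then the search, primitive recursive uniformly in the alphabet, the automaton and
`k`. -/

namespace HamJFA

/-! ### Hamming cost and correctness of the balance automaton -/

section Semantics

variable {α σ : Type*} [DecidableEq α]

theorem hamDist_append_singleton {v w : List α} (h : v.length = w.length) (b a : α) :
    hamDist (v ++ [b]) (w ++ [a]) = hamDist v w + if b = a then 0 else 1 := by
  unfold hamDist
  rw [List.zip_append h, List.countP_append]
  by_cases hab : b = a <;> simp [hab]

/-- The numbers of occurrences of a letter in two words differ by at most the Hamming distance. -/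
theorem abs_count_sub_count_le_hamDist {v w : List α} (h : v.length = w.length) (d : α) :
    |(v.count d : ℤ) - w.count d| ≤ hamDist v w := by
  induction v generalizing w with
  | nil =>
    obtain rfl : w = [] := List.length_eq_zero_iff.1 h.symm
    simp
  | cons b v ih =>
    obtain _ | ⟨a, w⟩ := w
    · simp at h
    have := ih (by simpa using h)
    have hd : hamDist (b :: v) (a :: w) = hamDist v w + if b = a then 0 else 1 := by
      by_cases hab : b = a <;> simp [hamDist, hab]
    rw [hd, List.count_cons, List.count_cons]
    rw [abs_le] at this ⊢
    push_cast
    by_cases hab : b = a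
    · subst hab
      simp only [if_true]
      constructor <;> linarith
    · simp only [hab, if_false]
      split_ifs <;> constructor <;> linarith

theorem hamDist_self (w : List α) : hamDist w w = 0 := by
  induction w with
  | nil => rfl
  | cons a w ih => simpa [hamDist] using ih

theorem hamCost_le_iff (A : NFA α σ) (w : List α) (k : ℕ) :
    hamCost A w ≤ k ↔ ∃ w' ∈ A.accepts, w'.Perm w ∧ hamDist w' w ≤ k := by
  constructor
  · intro h
    by_contra! hk
    -- Distances are integers, so if all of them exceed `k`, the infimum is at least `k + 1`; an
    -- empty infimum is `⊤` and is covered too.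
    have : ((k + 1 : ℕ) : ℕ∞) ≤ hamCost A w :=
      le_iInf₂ fun w' hw' => by exact_mod_cast hk w' hw'.1 hw'.2
    have := this.trans h
    norm_cast at this
    omega
  · rintro ⟨w', h, hp, hd⟩
    exact (iInf₂_le w' ⟨h, hp⟩).trans (by exact_mod_cast hd)

/-- The balance automaton reaches a state after `w` iff the simulated automaton reaches the
first component after a word of the recorded distance and balances. -/
theorem mem_balanceNFA_eval_iff (A : NFA α σ) (k : ℕ) (w : List α) (t : BalanceState α σ k) :
    t ∈ (balanceNFA A k).eval w ↔ ∃ v : List α, v.length = w.length ∧ t.1 ∈ A.eval v ∧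
      hamDist v w = t.2.2 ∧ ∀ d, (t.2.1 d : ℤ) = v.count d - w.count d := by
  induction w using List.reverseRecOn generalizing t with
  | nil =>
    constructor
    · rintro ⟨h1, h2, h3⟩
      exact ⟨[], rfl, h1, h3.symm, by simpa using h2⟩
    · rintro ⟨v, hv, h1, h2, h3⟩
      obtain rfl : v = [] := List.length_eq_zero_iff.1 hv
      exact ⟨h1, by simpa using h3, h2.symm⟩
  | append_singleton w a ih =>
    rw [NFA.eval_append_singleton, NFA.mem_stepSet]
    constructor
    · rintro ⟨s, hs, hst⟩
      obtain ⟨v, hv, h1, h2, h3⟩ := (ih s).1 hs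
      rcases hst with ⟨g1, g2, g3⟩ | ⟨b, hba, g1, g2, g3, g4, g5⟩
      · refine ⟨v ++ [a], by simp [hv], ?_, ?_, fun d => ?_⟩
        · rw [NFA.eval_append_singleton, NFA.mem_stepSet]
          exact ⟨_, h1, g1⟩
        · rw [hamDist_append_singleton hv, h2, g3]; simp
        · rw [g2, h3]; simp
      · refine ⟨v ++ [b], by simp [hv], ?_, ?_, fun d => ?_⟩
        · rw [NFA.eval_append_singleton, NFA.mem_stepSet]
          exact ⟨_, h1, g1⟩
        · rw [hamDist_append_singleton hv, h2, g2]; simp [hba]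
        · simp only [List.count_append, List.count_singleton']
          by_cases hda : d = a
          · subst hda
            rw [g3, h3]; simp [hba]; ring
          by_cases hdb : d = b
          · subst hdb
            rw [g4, h3]; simp [Ne.symm hba]; ring
          · rw [g5 d hda hdb, h3]; simp [Ne.symm hda, Ne.symm hdb]
    · rintro ⟨v', hv', h1, h2, h3⟩
      obtain ⟨v, b, rfl⟩ : ∃ v b, v' = v ++ [b] := by
        rcases List.eq_nil_or_concat v' with rfl | ⟨v, b, rfl⟩
        · simp at hv'
        · exact ⟨v, b, by simp⟩
      have hv : v.length = w.length := by simpa using hv'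
      rw [hamDist_append_singleton hv] at h2
      rw [NFA.eval_append_singleton, NFA.mem_stepSet] at h1
      obtain ⟨q, hq, hqt⟩ := h1
      have hk : hamDist v w < k + 1 := by have := t.2.2.2; omega
      -- The predecessor's components are forced by `v` and `w`. Its balances stay in range because
      -- the distance bounds them.
      have hbd (d : α) : (v.count d : ℤ) - w.count d ∈ Set.Icc (-(k : ℤ)) k := by
        have := abs_count_sub_count_le_hamDist hv d
        rw [Set.mem_Icc, ← abs_le]
        exact this.trans (by exact_mod_cast Nat.lt_succ_iff.1 hk)
      refine ⟨(q, fun d => ⟨_, hbd d⟩, ⟨hamDist v w, hk⟩),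
        (ih _).2 ⟨v, hv, hq, rfl, fun d => rfl⟩, ?_⟩
      simp only [List.count_append, List.count_singleton'] at h3
      by_cases hba : b = a
      · subst hba
        refine Or.inl ⟨hqt, ?_, ?_⟩
        · funext d
          apply Subtype.ext
          rw [h3]; push_cast; ring
        · apply Fin.ext
          simpa using h2.symm
      · refine Or.inr ⟨b, hba, hqt, ?_, ?_, ?_, fun d hda hdb => ?_⟩
        · simpa [hba] using h2.symm
        · rw [h3]; simp [hba]; ring
        · rw [h3]; simp [Ne.symm hba]; ring
        · apply Subtype.ext
          rw [h3]; simp [Ne.symm hda, Ne.symm hdb]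

theorem mem_balanceNFA_accepts_iff (A : NFA α σ) (k : ℕ) (w : List α) :
    w ∈ (balanceNFA A k).accepts ↔ hamCost A w ≤ k := by
  rw [hamCost_le_iff]
  constructor
  · rintro ⟨t, ⟨ht, h0⟩, hw⟩
    obtain ⟨v, hv, h1, h2, h3⟩ := (mem_balanceNFA_eval_iff A k w t).1 hw
    refine ⟨v, ⟨_, ht, h1⟩, List.perm_iff_count.2 fun d => ?_, ?_⟩
    · have := h3 d
      rw [h0] at this
      omega
    · have := t.2.2.2
      omega
  · rintro ⟨v, ⟨q, hq, hqv⟩, hp, hd⟩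
    refine ⟨(q, fun _ => ⟨0, by simp⟩, ⟨hamDist v w, by omega⟩), ⟨hq, fun _ => rfl⟩,
      (mem_balanceNFA_eval_iff A k w _).2 ⟨v, hp.length_eq, hqv, rfl, fun d => ?_⟩⟩
    simp [List.perm_iff_count.1 hp d]

theorem balanceNFA_accepts (A : NFA α σ) (k : ℕ) :
    (balanceNFA A k).accepts = {w : List α | hamCost A w ≤ k} :=
  Set.ext fun w => mem_balanceNFA_accepts_iff A k w

/-- Boundedness holds iff the language of the balance automaton is closed under exchanging two
adjacent letters. -/
theorem bnd_iff_forall_swap (A : NFA α σ) (k : ℕ) :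
    Bnd A k ↔ ∀ (u x : List α) (a b : α),
      hamCost A (u ++ a :: b :: x) ≤ k → hamCost A (u ++ b :: a :: x) ≤ k := by
  constructor
  · intro h u x a b hc
    obtain ⟨w', hw', hp, -⟩ := (hamCost_le_iff A _ k).1 hc
    exact h _ ⟨w', ((List.Perm.swap a b x).append_left u).trans hp.symm, hw'⟩
  · rintro h w ⟨v, hp, hv⟩
    -- The prefix `u` is quantified so that the `cons` case can move the common head letter into it.
    have key : ∀ {x y : List α}, x.Perm y → ∀ u : List α,
        hamCost A (u ++ x) ≤ k → hamCost A (u ++ y) ≤ k := by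
      intro x y hxy
      induction hxy with
      | nil => exact fun _ => id
      | cons a _ ih =>
        intro u hu
        simpa using ih (u ++ [a]) (by simpa using hu)
      | swap a b l => exact fun u => h u l b a
      | trans _ _ ih₁ ih₂ => exact fun u hu => ih₂ u (ih₁ u hu)
    -- The accepted word `v` has cost zero, and this bound is carried along the permutation from `v`
    -- to `w`.
    refine key hp.symm [] ((hamCost_le_iff A _ k).2 ⟨v, hv, .refl _, ?_⟩)
    simp [hamDist_self]

end Semantics

/-! ### Bounds on the length of counterexamples -/

section ShortWords

variable {α σ : Type*}

/-- A run at least as long as the number of states contains a loop; cutting it out keeps the final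
state and shortens the word. -/
theorem _root_.DFA.exists_length_lt_card_evalFrom_eq [Fintype σ] (D : DFA α σ) (s : σ)
    (w : List α) : ∃ v : List α, v.length < Fintype.card σ ∧ D.evalFrom s v = D.evalFrom s w := by
  induction hn : w.length using Nat.strong_induction_on generalizing w with
  | _ n ih =>
    by_cases hlt : w.length < Fintype.card σ
    · exact ⟨w, hlt, rfl⟩
    obtain ⟨q, a, b, c, rfl, -, hb, ha, hq, hc⟩ := D.evalFrom_split (not_lt.1 hlt) rfl
    have hb' := List.length_pos_iff.2 hb
    obtain ⟨v, hv, hv'⟩ := ih (a ++ c).length (by simp at hn ⊢; omega) (a ++ c) rfl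
    refine ⟨v, hv, hv'.trans ?_⟩
    rw [DFA.evalFrom_of_append, ha, hc]

theorem _root_.NFA.exists_length_lt_evalFrom_eq [Fintype σ] (M : NFA α σ) (S : Set σ)
    (w : List α) :
    ∃ v : List α, v.length < 2 ^ Fintype.card σ ∧ M.evalFrom S v = M.evalFrom S w := by
  classical
  rw [← Fintype.card_set]
  exact M.toDFA.exists_length_lt_card_evalFrom_eq S w

/-- One word must serve both sets, so the loop is cut in a deterministic automaton tracking pairs of
subsets, with `2 ^ n * 2 ^ n = 4 ^ n` states. -/
theorem _root_.NFA.exists_length_lt_evalFrom_eq_evalFrom_eq [Fintype σ] (M : NFA α σ)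
    (S T : Set σ) (w : List α) :
    ∃ v : List α, v.length < 4 ^ Fintype.card σ ∧ M.evalFrom S v = M.evalFrom S w ∧
      M.evalFrom T v = M.evalFrom T w := by
  classical
  let D : DFA α (Set σ × Set σ) :=
    { step := fun p a => (M.stepSet p.1 a, M.stepSet p.2 a), start := (∅, ∅), accept := ∅ }
  have hD : ∀ (x : List α) (p : Set σ × Set σ),
      D.evalFrom p x = (M.evalFrom p.1 x, M.evalFrom p.2 x) := by
    intro x
    induction x with
    | nil => exact fun _ => rfl
    | cons a x ih => exact fun p => ih (D.step p a)
  obtain ⟨v, hv, h⟩ := D.exists_length_lt_card_evalFrom_eq (S, T) w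
  rw [hD, hD, Prod.ext_iff] at h
  refine ⟨v, ?_, h⟩
  rwa [Fintype.card_prod, Fintype.card_set, ← mul_pow] at hv

theorem _root_.NFA.forall_mem_accepts_iff_length_le [Fintype σ] (M : NFA α σ) :
    (∀ w, w ∈ M.accepts) ↔ ∀ w : List α, w.length ≤ 4 ^ Fintype.card σ → w ∈ M.accepts := by
  refine ⟨fun h w _ => h w, fun h w => ?_⟩
  obtain ⟨v, hv, he⟩ := M.exists_length_lt_evalFrom_eq M.start w
  rw [NFA.mem_accepts, ← he]
  -- Length `2 ^ n` would do; `4 ^ n` lets both tests range over the same list of words.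
  exact h v (hv.le.trans (Nat.pow_le_pow_left (by norm_num) _))

/-- The prefix matters only through the set of states it reaches. The suffix matters only through
its action on the two sets reached after `ab` and after `ba`. -/
theorem _root_.NFA.forall_swap_iff_length_le [Fintype σ] (M : NFA α σ) :
    (∀ (u x : List α) (a b : α),
      u ++ a :: b :: x ∈ M.accepts → u ++ b :: a :: x ∈ M.accepts) ↔
    ∀ u : List α, u.length ≤ 4 ^ Fintype.card σ → ∀ x : List α, x.length ≤ 4 ^ Fintype.card σ →
      ∀ a b : α, u ++ a :: b :: x ∈ M.accepts → u ++ b :: a :: x ∈ M.accepts := by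
  refine ⟨fun h u _ x _ => h u x, fun h u x a b => ?_⟩
  obtain ⟨v, hv, he⟩ := M.exists_length_lt_evalFrom_eq M.start u
  obtain ⟨y, hy, h₁, h₂⟩ := M.exists_length_lt_evalFrom_eq_evalFrom_eq
    (M.evalFrom M.start (u ++ [a, b])) (M.evalFrom M.start (u ++ [b, a])) x
  have key := h v (hv.le.trans (Nat.pow_le_pow_left (by norm_num) _)) y hy.le a b
  simp only [NFA.evalFrom_append, NFA.evalFrom_cons, NFA.evalFrom_nil] at h₁ h₂
  simpa only [NFA.mem_accepts, NFA.evalFrom_append, NFA.evalFrom_cons, he, h₁, h₂] using key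

end ShortWords

/-! ### Primitive recursion with bounded quantifiers and lists -/

section Primrec

variable {α β γ : Type*} [Primcodable α] [Primcodable β] [Primcodable γ]

theorem _root_.PrimrecPred.forall_mem_list' {f : α → List β} {R : α → β → Prop}
    (hf : Primrec f) (hR : PrimrecRel R) : PrimrecPred fun a => ∀ b ∈ f a, R a b :=
  hR.swap.forall_mem_list.comp hf .id

theorem _root_.PrimrecPred.exists_mem_list' {f : α → List β} {R : α → β → Prop}
    (hf : Primrec f) (hR : PrimrecRel R) : PrimrecPred fun a => ∃ b ∈ f a, R a b :=
  hR.swap.exists_mem_list.comp hf .id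

theorem _root_.PrimrecPred.forall_lt' {f : α → ℕ} {R : α → ℕ → Prop}
    (hf : Primrec f) (hR : PrimrecRel R) : PrimrecPred fun a => ∀ b < f a, R a b :=
  (PrimrecPred.forall_mem_list' (Primrec.list_range.comp hf) hR).of_eq fun a => by simp

theorem _root_.PrimrecPred.exists_lt' {f : α → ℕ} {R : α → ℕ → Prop}
    (hf : Primrec f) (hR : PrimrecRel R) : PrimrecPred fun a => ∃ b < f a, R a b :=
  (PrimrecPred.exists_mem_list' (Primrec.list_range.comp hf) hR).of_eq fun a => by simp

theorem _root_.PrimrecPred.mem_list {f : α → β} {g : α → List β} (hf : Primrec f)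
    (hg : Primrec g) : PrimrecPred fun a => f a ∈ g a :=
  (PrimrecPred.exists_mem_list' (R := fun a b => b = f a) hg
    (Primrec.eq.comp .snd (hf.comp .fst))).of_eq fun a => by simp

theorem _root_.Primrec.list_filter' {f : α → List β} {p : α → β → Prop}
    [∀ a, DecidablePred (p a)] (hf : Primrec f) (hp : PrimrecRel p) :
    Primrec fun a => (f a).filter fun b => p a b := by
  classical
  exact (PrimrecRel.listFilter hp.swap).comp hf .id

theorem _root_.Primrec.nat_pow' : Primrec₂ ((· ^ ·) : ℕ → ℕ → ℕ) := by
  refine (Primrec.nat_rec (f := fun _ : ℕ => 1) (g := fun a p => p.2 * a) (.const 1)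
    (Primrec.nat_mul.comp (Primrec.snd.comp .snd) .fst)).of_eq fun a n => ?_
  induction n with
  | zero => simp
  | succ n ih => simp only [pow_succ, ih]

end Primrec

/-! ### Running described automata and searching short words -/

section Codes

theorem NFACode.primrec_equivProd : Primrec NFACode.equivProd :=
  Primrec.of_equiv (e := NFACode.equivProd)

theorem NFACode.primrec_numStates : Primrec NFACode.numStates :=
  Primrec.fst.comp primrec_equivProd

theorem NFACode.primrec_trans : Primrec NFACode.trans :=
  Primrec.fst.comp (Primrec.snd.comp primrec_equivProd)

theorem NFACode.primrec_init : Primrec NFACode.init :=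
  Primrec.fst.comp (Primrec.snd.comp (Primrec.snd.comp primrec_equivProd))

theorem NFACode.primrec_final : Primrec NFACode.final :=
  Primrec.snd.comp (Primrec.snd.comp (Primrec.snd.comp primrec_equivProd))

/-- The list of states that a description reaches from the states in `S` on the letter `a`. -/
def NFACode.stepList (c : NFACode) (S : List ℕ) (a : ℕ) : List ℕ :=
  (c.trans.filter fun t => t.1 ∈ S ∧ t.2.1 = a ∧ t.2.2 < c.numStates).map fun t => t.2.2

/-- The list of states that a description reaches on the word `w`. -/
def NFACode.reach (c : NFACode) (w : List ℕ) : List ℕ :=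
  w.foldl c.stepList (c.init.filter fun q => q < c.numStates)

/-- Acceptance of a word of natural numbers by a description. -/
def NFACode.Accepts (c : NFACode) (w : List ℕ) : Prop :=
  ∃ q ∈ c.reach w, q ∈ c.final

theorem NFACode.primrec_stepList :
    Primrec fun p : (NFACode × List ℕ) × ℕ => p.1.1.stepList p.1.2 p.2 := by
  have hcode : Primrec fun p : ((NFACode × List ℕ) × ℕ) × (ℕ × ℕ × ℕ) => p.1.1.1 :=
    Primrec.fst.comp (Primrec.fst.comp .fst)
  have hS : Primrec fun p : ((NFACode × List ℕ) × ℕ) × (ℕ × ℕ × ℕ) => p.1.1.2 :=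
    Primrec.snd.comp (Primrec.fst.comp .fst)
  have ht₁ : Primrec fun p : ((NFACode × List ℕ) × ℕ) × (ℕ × ℕ × ℕ) => p.2.1 :=
    Primrec.fst.comp .snd
  have ht₂ : Primrec fun p : ((NFACode × List ℕ) × ℕ) × (ℕ × ℕ × ℕ) => p.2.2.1 :=
    Primrec.fst.comp (Primrec.snd.comp .snd)
  have ht₃ : Primrec fun p : ((NFACode × List ℕ) × ℕ) × (ℕ × ℕ × ℕ) => p.2.2.2 :=
    Primrec.snd.comp (Primrec.snd.comp .snd)
  refine Primrec.list_map (Primrec.list_filter'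
    (primrec_trans.comp (Primrec.fst.comp .fst)) ?_) (Primrec.snd.comp (Primrec.snd.comp .snd))
  exact (PrimrecPred.mem_list ht₁ hS).and ((Primrec.eq.comp ht₂ (Primrec.snd.comp .fst)).and
    (Primrec.nat_lt.comp ht₃ (primrec_numStates.comp hcode)))

theorem NFACode.primrec_reach : Primrec₂ NFACode.reach := by
  refine Primrec.list_foldl (f := fun p : NFACode × List ℕ => p.2)
    (g := fun p => p.1.init.filter fun q => q < p.1.numStates)
    (h := fun p s => p.1.stepList s.1 s.2) .snd ?_ ?_
  · exact Primrec.list_filter' (primrec_init.comp .fst)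
      (Primrec.nat_lt.comp .snd (primrec_numStates.comp (Primrec.fst.comp .fst)))
  · exact primrec_stepList.comp (((Primrec.fst.comp .fst).pair (Primrec.fst.comp .snd)).pair
      (Primrec.snd.comp .snd))

theorem NFACode.primrecRel_accepts : PrimrecRel NFACode.Accepts :=
  PrimrecPred.exists_mem_list' primrec_reach
    (PrimrecPred.mem_list .snd (primrec_final.comp (Primrec.fst.comp .fst)))

theorem NFACode.mem_stepList {c : NFACode} {S : List ℕ} {a q : ℕ} :
    q ∈ c.stepList S a ↔ q < c.numStates ∧ ∃ p ∈ S, (p, a, q) ∈ c.trans := by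
  simp only [stepList, List.mem_map, List.mem_filter, decide_eq_true_eq]
  constructor
  · rintro ⟨⟨p, b, r⟩, ⟨h, hp, rfl, hr⟩, rfl⟩
    exact ⟨hr, p, hp, h⟩
  · rintro ⟨hq, p, hp, h⟩
    exact ⟨(p, a, q), ⟨h, hp, rfl, hq⟩, rfl⟩

theorem NFACode.mem_reach_iff (c : NFACode) (m : ℕ) (w : List (Fin m)) (q : ℕ) :
    q ∈ c.reach (w.map Fin.val) ↔
      ∃ i : Fin c.numStates, (i : ℕ) = q ∧ i ∈ (c.toNFA m).eval w := by
  induction w using List.reverseRecOn generalizing q with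
  | nil =>
    simp only [reach, List.map_nil, List.foldl_nil, List.mem_filter, decide_eq_true_eq]
    constructor
    · rintro ⟨h, hq⟩
      exact ⟨⟨q, hq⟩, rfl, h⟩
    · rintro ⟨i, rfl, h⟩
      exact ⟨h, i.2⟩
  | append_singleton w a ih =>
    have hr : c.reach ((w ++ [a]).map Fin.val) = c.stepList (c.reach (w.map Fin.val)) a := by
      simp [reach]
    rw [hr, mem_stepList, NFA.eval_append_singleton]
    simp only [NFA.mem_stepSet]
    constructor
    · rintro ⟨hq, p, hp, h⟩
      obtain ⟨i, rfl, hi⟩ := (ih p).1 hp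
      exact ⟨⟨q, hq⟩, rfl, i, hi, h⟩
    · rintro ⟨j, rfl, i, hi, h⟩
      exact ⟨j.2, i, (ih i).2 ⟨i, rfl, hi⟩, h⟩

theorem NFACode.accepts_iff (c : NFACode) (m : ℕ) (w : List (Fin m)) :
    c.Accepts (w.map Fin.val) ↔ w ∈ (c.toNFA m).accepts := by
  constructor
  · rintro ⟨q, hq, hf⟩
    obtain ⟨i, rfl, hi⟩ := (c.mem_reach_iff m w q).1 hq
    exact ⟨i, hf, hi⟩
  · rintro ⟨i, hf, hi⟩
    exact ⟨i, (c.mem_reach_iff m w i).2 ⟨i, rfl, hi⟩, hf⟩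

/-- The words of length at most `n` over the letters `0, …, m - 1`. -/
def words (m : ℕ) : ℕ → List (List ℕ)
  | 0 => [[]]
  | n + 1 => [] :: (words m n).flatMap fun w => (List.range m).map fun a => a :: w

theorem primrec_words : Primrec₂ words := by
  refine (Primrec.nat_rec (f := fun _ : ℕ => [([] : List ℕ)])
    (g := fun m p => [] :: p.2.flatMap fun w => (List.range m).map fun a => a :: w)
    (.const _) ?_).of_eq fun m n => ?_
  · refine Primrec.list_cons.comp (.const _) (Primrec.list_flatMap (Primrec.snd.comp .snd) ?_)
    exact Primrec.list_map (Primrec.list_range.comp (Primrec.fst.comp .fst))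
      (Primrec.list_cons.comp .snd (Primrec.snd.comp .fst))
  · induction n with
    | zero => rfl
    | succ n ih => simp only [words, ih]

theorem mem_words {m n : ℕ} {w : List ℕ} :
    w ∈ words m n ↔ w.length ≤ n ∧ ∀ a ∈ w, a < m := by
  induction n generalizing w with
  | zero =>
    simp only [words, List.mem_singleton, Nat.le_zero, List.length_eq_zero_iff]
    constructor
    · rintro rfl; simp
    · exact And.left
  | succ n ih =>
    obtain _ | ⟨a, w⟩ := w
    · simp [words]
    · simp only [words, List.mem_cons, reduceCtorEq, false_or, List.mem_flatMap, List.mem_map,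
        List.mem_range, List.cons.injEq, List.length_cons, Nat.add_le_add_iff_right,
        forall_eq_or_imp, ih]
      constructor
      · rintro ⟨_, ⟨h₁, h₂⟩, _, h, rfl, rfl⟩
        exact ⟨h₁, h, h₂⟩
      · rintro ⟨h₁, h, h₂⟩
        exact ⟨w, ⟨h₁, h₂⟩, a, h, rfl, rfl⟩

theorem forall_mem_words {m n : ℕ} {p : List ℕ → Prop} :
    (∀ w ∈ words m n, p w) ↔ ∀ w : List (Fin m), w.length ≤ n → p (w.map Fin.val) := by
  constructor
  · intro h w hw
    refine h _ (mem_words.2 ⟨by simpa using hw, ?_⟩)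
    simp only [List.mem_map]
    rintro _ ⟨a, -, rfl⟩
    exact a.2
  · intro h w hw
    obtain ⟨hl, hw⟩ := mem_words.1 hw
    lift w to List (Fin m) using hw
    exact h w (by simpa using hl)

theorem primrec_shortWords :
    Primrec fun p : NFACode × ℕ => words p.2 (4 ^ p.1.numStates) :=
  primrec_words.comp .snd (Primrec.nat_pow'.comp (.const 4)
    (NFACode.primrec_numStates.comp .fst))

/-- Universality of described automata is primitive recursive. -/
theorem primrecPred_universal :
    PrimrecPred fun p : NFACode × ℕ => ∀ w, w ∈ (p.1.toNFA p.2).accepts := by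
  have main : PrimrecPred fun p : NFACode × ℕ =>
      ∀ w ∈ words p.2 (4 ^ p.1.numStates), p.1.Accepts w :=
    PrimrecPred.forall_mem_list' primrec_shortWords
      (NFACode.primrecRel_accepts.comp (Primrec.fst.comp .fst) .snd)
  refine main.of_eq fun p => ?_
  rw [forall_mem_words, NFA.forall_mem_accepts_iff_length_le]
  simp [NFACode.accepts_iff]

/-- Closure of the language of a described automaton under exchanging adjacent letters is
primitive recursive. -/
theorem primrecPred_swapClosed :
    PrimrecPred fun p : NFACode × ℕ => ∀ (u x : List (Fin p.2)) (a b : Fin p.2),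
      u ++ a :: b :: x ∈ (p.1.toNFA p.2).accepts →
        u ++ b :: a :: x ∈ (p.1.toNFA p.2).accepts := by
  have main : PrimrecPred fun p : NFACode × ℕ => ∀ u ∈ words p.2 (4 ^ p.1.numStates),
      ∀ x ∈ words p.2 (4 ^ p.1.numStates), ∀ a < p.2, ∀ b < p.2,
        -- The implication is written with negation and disjunction, under which primitive recursive
        -- predicates are closed.
        ¬ p.1.Accepts (u ++ a :: b :: x) ∨ p.1.Accepts (u ++ b :: a :: x) := by
    refine PrimrecPred.forall_mem_list' primrec_shortWords ?_
    refine PrimrecPred.forall_mem_list' (primrec_shortWords.comp .fst) ?_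
    refine PrimrecPred.forall_lt' (Primrec.snd.comp (Primrec.fst.comp .fst)) ?_
    refine PrimrecPred.forall_lt' (Primrec.snd.comp (Primrec.fst.comp (Primrec.fst.comp .fst))) ?_
    let X := ((((NFACode × ℕ) × List ℕ) × List ℕ) × ℕ) × ℕ
    have hc : Primrec fun p : X => p.1.1.1.1.1 :=
      Primrec.fst.comp (Primrec.fst.comp (Primrec.fst.comp (Primrec.fst.comp .fst)))
    have hu : Primrec fun p : X => p.1.1.1.2 :=
      Primrec.snd.comp (Primrec.fst.comp (Primrec.fst.comp .fst))
    have hx : Primrec fun p : X => p.1.1.2 := Primrec.snd.comp (Primrec.fst.comp .fst)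
    have ha : Primrec fun p : X => p.1.2 := Primrec.snd.comp .fst
    have hb : Primrec fun p : X => p.2 := .snd
    exact (NFACode.primrecRel_accepts.comp hc (Primrec.list_append.comp hu
      (Primrec.list_cons.comp ha (Primrec.list_cons.comp hb hx)))).not.or
      (NFACode.primrecRel_accepts.comp hc (Primrec.list_append.comp hu
      (Primrec.list_cons.comp hb (Primrec.list_cons.comp ha hx))))
  refine main.of_eq fun p => ?_
  rw [forall_mem_words, NFA.forall_swap_iff_length_le]
  simp only [forall_mem_words, Fintype.card_fin, ← NFACode.accepts_iff, List.map_append,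
    List.map_cons, Fin.forall_iff, ← imp_iff_not_or]

end Codes

/-! ### Effective construction of the balance automaton -/

section BalanceCode

/-- The component in `σ` of the state of the balance automaton with number `s`. -/
def stateDigit (m k s : ℕ) : ℕ := s / ((2 * k + 1) ^ m * (k + 1))

/-- The balance of the letter `d`, increased by `k`, in the state with number `s`. -/
def balanceDigit (m k s d : ℕ) : ℕ :=
  s % ((2 * k + 1) ^ m * (k + 1)) / (k + 1) / (2 * k + 1) ^ d % (2 * k + 1)

/-- The number of swapped letters in the state with number `s`. -/
def costDigit (m k s : ℕ) : ℕ := s % ((2 * k + 1) ^ m * (k + 1)) % (k + 1)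

/-- The balances `-k, …, k` are numbered `0, …, 2 * k`. -/
def finEquivIcc (k : ℕ) : Fin (2 * k + 1) ≃ Set.Icc (-(k : ℤ)) (k : ℤ) where
  toFun i := ⟨(i : ℤ) - k, by constructor <;> have := i.2 <;> omega⟩
  invFun z := ⟨((z : ℤ) + k).toNat, by have := z.2.1; have := z.2.2; omega⟩
  left_inv i := by ext; simp
  right_inv z := by
    have := z.2.1
    apply Subtype.ext
    simp only
    omega

/-- The numbering of the states of the balance automaton. -/
def finEquivBalanceState (n m k : ℕ) :
    Fin (n * ((2 * k + 1) ^ m * (k + 1))) ≃ BalanceState (Fin m) (Fin n) k :=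
  finProdFinEquiv.symm.trans <| Equiv.prodCongr (Equiv.refl _) <|
    finProdFinEquiv.symm.trans <| Equiv.prodCongr
      (finFunctionFinEquiv.symm.trans <| Equiv.arrowCongr (Equiv.refl _) (finEquivIcc k))
      (Equiv.refl _)

/-- With `B = 2 * k + 1`, the state `(q, f, c)` has number `q * (B ^ m * (k + 1)) + F * (k + 1) +
c`, where `F` has the base-`B` digits `f d + k`. The digit functions repeat the divisions by which
the equivalence decodes this, so the three identities are definitional. -/
theorem finEquivBalanceState_fst (n m k : ℕ) (s : Fin (n * ((2 * k + 1) ^ m * (k + 1)))) :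
    ((finEquivBalanceState n m k s).1 : ℕ) = stateDigit m k s := rfl

theorem finEquivBalanceState_balance (n m k : ℕ) (s : Fin (n * ((2 * k + 1) ^ m * (k + 1))))
    (d : Fin m) :
    ((finEquivBalanceState n m k s).2.1 d : ℤ) = balanceDigit m k s d - k := rfl

theorem finEquivBalanceState_cost (n m k : ℕ) (s : Fin (n * ((2 * k + 1) ^ m * (k + 1)))) :
    ((finEquivBalanceState n m k s).2.2 : ℕ) = costDigit m k s := rfl

/-- The transition relation of the balance automaton on numbers of states. -/
def BalanceStep (J : JFACode) (k s a t : ℕ) : Prop :=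
  ((stateDigit J.1 k s, a, stateDigit J.1 k t) ∈ J.2.trans ∧
    (∀ d < J.1, balanceDigit J.1 k t d = balanceDigit J.1 k s d) ∧
    costDigit J.1 k t = costDigit J.1 k s) ∨
  ∃ b < J.1, ¬b = a ∧ (stateDigit J.1 k s, b, stateDigit J.1 k t) ∈ J.2.trans ∧
    costDigit J.1 k t = costDigit J.1 k s + 1 ∧
    -- The decrement is stated as an addition on the other side, to avoid truncated subtraction.
    balanceDigit J.1 k t a + 1 = balanceDigit J.1 k s a ∧
    balanceDigit J.1 k t b = balanceDigit J.1 k s b + 1 ∧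
    ∀ d < J.1, d = a ∨ d = b ∨ balanceDigit J.1 k t d = balanceDigit J.1 k s d

/-- All balances are zero in the state with number `s`. -/
def Balanced (m k s : ℕ) : Prop := ∀ d < m, balanceDigit m k s d = k

open Classical in
/-- The description of the balance automaton. -/
noncomputable def balanceCode (p : JFACode × ℕ) : NFACode where
  numStates := p.1.2.numStates * ((2 * p.2 + 1) ^ p.1.1 * (p.2 + 1))
  trans :=
    ((List.range (p.1.2.numStates * ((2 * p.2 + 1) ^ p.1.1 * (p.2 + 1)))).flatMap fun s =>
      (List.range p.1.1).flatMap fun a =>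
        (List.range (p.1.2.numStates * ((2 * p.2 + 1) ^ p.1.1 * (p.2 + 1)))).map fun t =>
          (s, a, t)).filter fun x => BalanceStep p.1 p.2 x.1 x.2.1 x.2.2
  init := (List.range (p.1.2.numStates * ((2 * p.2 + 1) ^ p.1.1 * (p.2 + 1)))).filter fun s =>
    stateDigit p.1.1 p.2 s ∈ p.1.2.init ∧ Balanced p.1.1 p.2 s ∧ costDigit p.1.1 p.2 s = 0
  final := (List.range (p.1.2.numStates * ((2 * p.2 + 1) ^ p.1.1 * (p.2 + 1)))).filter fun s =>
    stateDigit p.1.1 p.2 s ∈ p.1.2.final ∧ Balanced p.1.1 p.2 s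

section Primrec

variable {α : Type*} [Primcodable α] {m k s d : α → ℕ}

theorem primrec_balanceSize (hm : Primrec m) (hk : Primrec k) :
    Primrec fun x => (2 * k x + 1) ^ m x * (k x + 1) :=
  Primrec.nat_mul.comp (Primrec.nat_pow'.comp
    (Primrec.succ.comp (Primrec.nat_mul.comp (.const 2) hk)) hm) (Primrec.succ.comp hk)

theorem primrec_stateDigit (hm : Primrec m) (hk : Primrec k) (hs : Primrec s) :
    Primrec fun x => stateDigit (m x) (k x) (s x) :=
  Primrec.nat_div.comp hs (primrec_balanceSize hm hk)

theorem primrec_costDigit (hm : Primrec m) (hk : Primrec k) (hs : Primrec s) :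
    Primrec fun x => costDigit (m x) (k x) (s x) :=
  Primrec.nat_mod.comp (Primrec.nat_mod.comp hs (primrec_balanceSize hm hk))
    (Primrec.succ.comp hk)

theorem primrec_balanceDigit (hm : Primrec m) (hk : Primrec k) (hs : Primrec s)
    (hd : Primrec d) : Primrec fun x => balanceDigit (m x) (k x) (s x) (d x) := by
  have hK := Primrec.succ.comp (Primrec.nat_mul.comp (.const 2) hk)
  exact Primrec.nat_mod.comp (Primrec.nat_div.comp (Primrec.nat_div.comp
    (Primrec.nat_mod.comp hs (primrec_balanceSize hm hk)) (Primrec.succ.comp hk))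
    (Primrec.nat_pow'.comp hK hd)) hK

theorem primrecPred_balanced (hm : Primrec m) (hk : Primrec k) (hs : Primrec s) :
    PrimrecPred fun x => Balanced (m x) (k x) (s x) :=
  PrimrecPred.forall_lt' hm (Primrec.eq.comp
    (primrec_balanceDigit (hm.comp .fst) (hk.comp .fst) (hs.comp .fst) .snd) (hk.comp .fst))

theorem primrecPred_balanceStep {J : α → JFACode} {a t : α → ℕ} (hJ : Primrec J)
    (hk : Primrec k) (hs : Primrec s) (ha : Primrec a) (ht : Primrec t) :
    PrimrecPred fun x => BalanceStep (J x) (k x) (s x) (a x) (t x) := by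
  have hm : Primrec fun x => (J x).1 := Primrec.fst.comp hJ
  have hT : Primrec fun x => (J x).2.trans := NFACode.primrec_trans.comp (Primrec.snd.comp hJ)
  have hm' : Primrec fun x : α × ℕ => (J x.1).1 := hm.comp .fst
  have hk' : Primrec fun x : α × ℕ => k x.1 := hk.comp .fst
  have hs' : Primrec fun x : α × ℕ => s x.1 := hs.comp .fst
  have ha' : Primrec fun x : α × ℕ => a x.1 := ha.comp .fst
  have ht' : Primrec fun x : α × ℕ => t x.1 := ht.comp .fst
  have hb : Primrec fun x : α × ℕ => x.2 := .snd
  refine PrimrecPred.or (PrimrecPred.and ?_ (PrimrecPred.and ?_ ?_))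
    (PrimrecPred.exists_lt' hm (PrimrecPred.and ?_ (PrimrecPred.and ?_ (PrimrecPred.and ?_
      (PrimrecPred.and ?_ (PrimrecPred.and ?_ (PrimrecPred.forall_lt' hm' ?_)))))))
  · exact PrimrecPred.mem_list ((primrec_stateDigit hm hk hs).pair
      (ha.pair (primrec_stateDigit hm hk ht))) hT
  · exact PrimrecPred.forall_lt' hm (Primrec.eq.comp (primrec_balanceDigit hm' hk' ht' hb)
      (primrec_balanceDigit hm' hk' hs' hb))
  · exact Primrec.eq.comp (primrec_costDigit hm hk ht) (primrec_costDigit hm hk hs)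
  · exact (Primrec.eq.comp hb ha').not
  · exact PrimrecPred.mem_list ((primrec_stateDigit hm' hk' hs').pair
      (hb.pair (primrec_stateDigit hm' hk' ht'))) (hT.comp .fst)
  · exact Primrec.eq.comp (primrec_costDigit hm' hk' ht')
      (Primrec.succ.comp (primrec_costDigit hm' hk' hs'))
  · exact Primrec.eq.comp (Primrec.succ.comp (primrec_balanceDigit hm' hk' ht' ha'))
      (primrec_balanceDigit hm' hk' hs' ha')
  · exact Primrec.eq.comp (primrec_balanceDigit hm' hk' ht' hb)
      (Primrec.succ.comp (primrec_balanceDigit hm' hk' hs' hb))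
  · have hd : Primrec fun x : (α × ℕ) × ℕ => x.2 := .snd
    exact (Primrec.eq.comp hd (ha'.comp .fst)).or ((Primrec.eq.comp hd (hb.comp .fst)).or
      (Primrec.eq.comp
        (primrec_balanceDigit (hm'.comp .fst) (hk'.comp .fst) (ht'.comp .fst) hd)
        (primrec_balanceDigit (hm'.comp .fst) (hk'.comp .fst) (hs'.comp .fst) hd)))

end Primrec

/-- The classical decision procedures in the filters do no harm: each filtering predicate is shown
to be primitive recursive. -/
theorem primrec_balanceCode : Primrec balanceCode := by
  classical
  have hm : Primrec fun p : JFACode × ℕ => p.1.1 := Primrec.fst.comp .fst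
  have hc : Primrec fun p : JFACode × ℕ => p.1.2 := Primrec.snd.comp .fst
  have hk : Primrec fun p : JFACode × ℕ => p.2 := .snd
  have hN : Primrec fun p : JFACode × ℕ =>
      p.1.2.numStates * ((2 * p.2 + 1) ^ p.1.1 * (p.2 + 1)) :=
    Primrec.nat_mul.comp (NFACode.primrec_numStates.comp hc) (primrec_balanceSize hm hk)
  have hm' : Primrec fun p : (JFACode × ℕ) × ℕ => p.1.1.1 := hm.comp .fst
  have hk' : Primrec fun p : (JFACode × ℕ) × ℕ => p.1.2 := hk.comp .fst
  have hs : Primrec fun p : (JFACode × ℕ) × ℕ => p.2 := .snd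
  have hbal := primrecPred_balanced hm' hk' hs
  have hst := primrec_stateDigit hm' hk' hs
  have h : Primrec fun p => NFACode.equivProd (balanceCode p) := by
    refine hN.pair (Primrec.pair ?_ (Primrec.pair ?_ ?_))
    · refine Primrec.list_filter' (Primrec.list_flatMap (Primrec.list_range.comp hN) ?_) ?_
      · refine Primrec.list_flatMap (Primrec.list_range.comp (hm.comp .fst)) ?_
        exact Primrec.list_map
          (Primrec.list_range.comp (hN.comp (Primrec.fst.comp .fst)))
          ((Primrec.snd.comp (Primrec.fst.comp .fst)).pair
            ((Primrec.snd.comp .fst).pair .snd))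
      · exact primrecPred_balanceStep (Primrec.fst.comp .fst) (Primrec.snd.comp .fst)
          (Primrec.fst.comp .snd) (Primrec.fst.comp (Primrec.snd.comp .snd))
          (Primrec.snd.comp (Primrec.snd.comp .snd))
    · exact Primrec.list_filter' (Primrec.list_range.comp hN)
        ((PrimrecPred.mem_list hst (NFACode.primrec_init.comp (hc.comp .fst))).and
          (hbal.and (Primrec.eq.comp (primrec_costDigit hm' hk' hs) (.const 0))))
    · exact Primrec.list_filter' (Primrec.list_range.comp hN)
        ((PrimrecPred.mem_list hst (NFACode.primrec_final.comp (hc.comp .fst))).and hbal)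
  exact ((Primrec.of_equiv_symm (e := NFACode.equivProd)).comp h).of_eq fun p =>
    NFACode.equivProd.symm_apply_apply _

theorem mem_balanceCode_trans {J : JFACode} {k s a t : ℕ} :
    (s, a, t) ∈ (balanceCode (J, k)).trans ↔
      (s < (balanceCode (J, k)).numStates ∧ a < J.1 ∧ t < (balanceCode (J, k)).numStates) ∧
        BalanceStep J k s a t := by
  simp only [balanceCode, List.mem_filter, List.mem_flatMap, List.mem_map, List.mem_range,
    decide_eq_true_eq, Prod.mk.injEq]
  refine and_congr_left fun _ => ⟨?_, fun ⟨hs, ha, ht⟩ => ⟨s, hs, a, ha, t, ht, rfl, rfl, rfl⟩⟩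
  rintro ⟨_, hs, _, ha, _, ht, rfl, rfl, rfl⟩
  exact ⟨hs, ha, ht⟩

theorem mem_balanceCode_init {J : JFACode} {k s : ℕ} :
    s ∈ (balanceCode (J, k)).init ↔ s < (balanceCode (J, k)).numStates ∧
      stateDigit J.1 k s ∈ J.2.init ∧ Balanced J.1 k s ∧ costDigit J.1 k s = 0 := by
  simp only [balanceCode, List.mem_filter, List.mem_range, decide_eq_true_eq]

theorem mem_balanceCode_final {J : JFACode} {k s : ℕ} :
    s ∈ (balanceCode (J, k)).final ↔ s < (balanceCode (J, k)).numStates ∧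
      stateDigit J.1 k s ∈ J.2.final ∧ Balanced J.1 k s := by
  simp only [balanceCode, List.mem_filter, List.mem_range, decide_eq_true_eq]

theorem balanced_iff {n m k : ℕ} (s : Fin (n * ((2 * k + 1) ^ m * (k + 1)))) :
    Balanced m k s ↔ ∀ a, ((finEquivBalanceState n m k s).2.1 a : ℤ) = 0 := by
  simp only [finEquivBalanceState_balance, Balanced, Fin.forall_iff]
  exact forall₂_congr fun d _ => by omega

/-- Digits are balances shifted by `k`, and the shift cancels in every equation between old and new
balances. -/
theorem balanceStep_iff (J : JFACode) (k : ℕ)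
    (s t : Fin (J.2.numStates * ((2 * k + 1) ^ J.1 * (k + 1)))) (a : Fin J.1) :
    BalanceStep J k s a t ↔ finEquivBalanceState J.2.numStates J.1 k t ∈
      (balanceNFA J.toNFA k).step (finEquivBalanceState J.2.numStates J.1 k s) a := by
  simp only [balanceNFA, Set.mem_ofPred_eq, funext_iff, Subtype.ext_iff, Fin.ext_iff,
    finEquivBalanceState_balance, finEquivBalanceState_cost, JFACode.toNFA, NFACode.toNFA,
    finEquivBalanceState_fst, Fin.forall_iff, Fin.exists_iff, ne_eq, BalanceStep]
  refine or_congr (and_congr_right fun _ => and_congr_left fun _ =>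
    forall₂_congr fun d _ => by omega) (exists_congr fun b => ?_)
  rw [exists_prop]
  refine and_congr_right fun _ => and_congr_right fun _ => and_congr_right fun _ =>
    and_congr_right fun _ => and_congr (by omega) (and_congr (by omega)
    (forall₂_congr fun d _ => ?_))
  omega

theorem isomorphic_balanceCode (J : JFACode) (k : ℕ) :
    Isomorphic ((balanceCode (J, k)).toNFA J.1) (balanceNFA J.toNFA k) := by
  refine ⟨finEquivBalanceState J.2.numStates J.1 k, fun s a t => ?_, fun s => ?_, fun s => ?_⟩
  · exact mem_balanceCode_trans.trans
      ((and_iff_right ⟨s.2, a.2, t.2⟩).trans (balanceStep_iff J k s t a))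
  · exact mem_balanceCode_init.trans ((and_iff_right s.2).trans
      (and_congr Iff.rfl (and_congr (balanced_iff (n := J.2.numStates) s) Iff.rfl)))
  · exact mem_balanceCode_final.trans ((and_iff_right s.2).trans
      (and_congr Iff.rfl (balanced_iff (n := J.2.numStates) s)))

theorem Isomorphic.accepts_eq {α σ τ : Type*} {A : NFA α σ} {B : NFA α τ}
    (h : Isomorphic A B) : A.accepts = B.accepts := by
  obtain ⟨e, hstep, hstart, hacc⟩ := h
  have heval : ∀ (w : List α) (s : σ), s ∈ A.eval w ↔ e s ∈ B.eval w := by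
    intro w
    induction w using List.reverseRecOn with
    | nil => exact hstart
    | append_singleton w a ih =>
      intro t
      simp only [NFA.eval_append_singleton, NFA.mem_stepSet, ih, hstep, e.exists_congr_left,
        Equiv.apply_symm_apply]
  ext w
  have : (∃ s, s ∈ A.accept ∧ s ∈ A.eval w) ↔ ∃ s, s ∈ B.accept ∧ s ∈ B.eval w := by
    simp only [heval, hacc, e.exists_congr_left, Equiv.apply_symm_apply]
  exact this

theorem balanceCode_accepts (J : JFACode) (k : ℕ) :
    ((balanceCode (J, k)).toNFA J.1).accepts =
      {w : List (Fin J.1) | hamCost J.toNFA w ≤ k} :=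
  (isomorphic_balanceCode J k).accepts_eq.trans (balanceNFA_accepts _ _)

theorem primrec_balanceCode_pair :
    Primrec fun p : JFACode × ℕ => (balanceCode p, p.1.1) :=
  primrec_balanceCode.pair (Primrec.fst.comp .fst)

theorem primrecPred_bnd : PrimrecPred fun p : JFACode × ℕ => Bnd p.1.toNFA p.2 := by
  refine (primrecPred_swapClosed.comp primrec_balanceCode_pair).of_eq fun p => ?_
  rw [bnd_iff_forall_swap]
  simp only [balanceCode_accepts p.1 p.2]
  rfl

theorem primrecPred_univBnd : PrimrecPred fun p : JFACode × ℕ => UnivBnd p.1.toNFA p.2 := by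
  refine (primrecPred_universal.comp primrec_balanceCode_pair).of_eq fun p => ?_
  simp only [balanceCode_accepts p.1 p.2]
  rfl

end BalanceCode

end HamJFA

/-! ### The main theorem -/

theorem mainTheorem3 :
    -- the balance automaton accepts exactly the words of cost at most `k`
    (∀ (α σ : Type*) [Fintype α] [DecidableEq α] [Fintype σ] (A : NFA α σ) (k : ℕ),
      (HamJFA.balanceNFA A k).accepts = {w : List α | HamJFA.hamCost A w ≤ k}) ∧
    -- and it can be constructed effectively from the given automaton and `k`
    (∃ F : HamJFA.JFACode × ℕ → HamJFA.NFACode, Computable F ∧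
      ∀ (J : HamJFA.JFACode) (k : ℕ),
        HamJFA.Isomorphic ((F (J, k)).toNFA J.1) (HamJFA.balanceNFA J.toNFA k) ∧
        ((F (J, k)).toNFA J.1).accepts =
          {w : List (Fin J.1) | HamJFA.hamCost J.toNFA w ≤ k}) ∧
    -- `k`-boundedness, for each fixed `k`
    (∀ k : ℕ, ComputablePred fun J : HamJFA.JFACode => HamJFA.Bnd J.toNFA k) ∧
    -- parametric boundedness
    (ComputablePred fun p : HamJFA.JFACode × ℕ => HamJFA.Bnd p.1.toNFA p.2) ∧
    -- universal `k`-boundedness, for each fixed `k`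
    (∀ k : ℕ, ComputablePred fun J : HamJFA.JFACode => HamJFA.UnivBnd J.toNFA k) ∧
    -- universal parametric boundedness
    (ComputablePred fun p : HamJFA.JFACode × ℕ => HamJFA.UnivBnd p.1.toNFA p.2) := by
  -- The problems with fixed `k` are the parametric ones precomposed with this map.
  have hk (k : ℕ) : Primrec fun J : HamJFA.JFACode => (J, k) := Primrec.pair .id (.const k)
  exact ⟨fun α σ _ _ _ A k => HamJFA.balanceNFA_accepts A k,
    ⟨HamJFA.balanceCode, HamJFA.primrec_balanceCode.to_comp, fun J k =>
      ⟨HamJFA.isomorphic_balanceCode J k, HamJFA.balanceCode_accepts J k⟩⟩,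
    fun k => (HamJFA.primrecPred_bnd.comp (hk k)).computablePred,
    HamJFA.primrecPred_bnd.computablePred,
    fun k => (HamJFA.primrecPred_univBnd.comp (hk k)).computablePred,
    HamJFA.primrecPred_univBnd.computablePred⟩
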